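/- Let $X$ be a C*-algebra and let $\mathcal F\subset X^*$ be a norm-closed subspace such that $(X,\mathcal F)$ is a dual pair of Banach spaces: $\|x\|=\sup\{|\varphi(x)|:\varphi\in\mathcal F,\ \|\varphi\|\le 1\}$ for $x\in X$; $\|\varphi\|=\sup\{|\varphi(x)|:x\in X,\ \|x\|\le 1\}$ for $\varphi\in\mathcal F$; the convex hull of every relatively $\mathcal F$-compact subset of $X$ is relatively $\mathcal F$-compact; and the convex hull of every relatively $X$-compact subset of $\mathcal F$ is relatively $X$-compact. Here the $\mathcal F$-topology on $X$ is $\sigma(X,\mathcal F)$, the $X$-topology on $\mathcal F$ is $\sigma(\mathcal F,X)$, and $\overline{\,\cdot\,}^{\sigma}$ denotes closure in the $\mathcal F$-topology. Assume that the involution of $X$ is $\mathcal F$-continuous and that the multiplication of $X$ is separately $\mathcal F$-continuous. Let $G$ be a compact group and let $\alpha:G\to\mathrm{Aut}(X)$ be a homomorphism into the group of $*$-automorphisms of $X$ such that $(X,G,\alpha)$ is an $\mathcal F$-dynamical system: every $\alpha_g$ is $\mathcal F$-continuous, and $g\mapsto\varphi(\alpha_g(x))$ is continuous for all $x\in X$,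 $\varphi\in\mathcal F$. Let $X^\alpha=\{x\in X:\alpha_g(x)=x\ \text{for all } g\in G\}$. Let $\widehat G$ be the set of unitary equivalence classes of (continuous, hence finite-dimensional) irreducible unitary representations of $G$; for each class fix a representative $\pi$ on $H_\pi$, written as a matrix-valued function in an orthonormal basis, and identify $X\otimes B(H_\pi)$ with the matrices over $X$, with the topology of entrywise $\mathcal F$-convergence. For an $\mathcal F$-closed $\alpha$-invariant $*$-subalgebra $Y\subset X$ put $$Y_2(\pi)=\{a\in Y\otimes B(H_\pi):(\alpha_g\otimes\iota)(a)=a(1\otimes\pi_g)\ \text{for all } g\in G\},$$ $$(Y\otimes B(H_\pi))^{\alpha\otimes \mathrm{ad}\,\pi}=\{a\in Y\otimes B(H_\pi):(1\otimes\pi_g)\,(\alpha_g\otimes\iota)(a)\,(1\otimes\pi_{g^{-1}})=a\ \text{for all } g\in G\},$$ and let $Y_2(\pi)^*Y_2(\pi)$ be the linear span of the products $a^*b$ with $a,b\in Y_2(\pi)$. The strong Arveson spectrum of the restricted action is $$\widetilde{sp}_{\mathcal F}(\alpha|_Y)=\{\pi\in\widehat G:\overline{Y_2(\pi)^*Y_2(\pi)}^{\sigma}=(Y\otimes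 B(H_\pi))^{\alpha\otimes \mathrm{ad}\,\pi}\}.$$ The strong Connes spectrum is $$\widetilde\Gamma_{\mathcal F}(\alpha)=\bigcap\{\widetilde{sp}_{\mathcal F}(\alpha|_Y): Y\in\mathcal H^\alpha_\sigma(X)\},$$ where $\mathcal H^\alpha_\sigma(X)$ is the set of all non-zero globally $\alpha$-invariant $\mathcal F$-closed hereditary C*-subalgebras of $X$. (An intersection over an empty family is $\widehat G$.) Then $$\widetilde\Gamma_{\mathcal F}(\alpha)=\bigcap\big\{\widetilde{sp}_{\mathcal F}\big(\alpha|_{\overline{JXJ}^{\sigma}}\big): J\subset X^\alpha\ \text{an } \mathcal F\text{-closed two-sided ideal of } X^\alpha\big\},$$ where $JXJ$ denotes the linear span of the products $jxk$ with $j,k\in J$, $x\in X$. -/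

import Mathlib

open Topology

namespace FDyn

section DualPair

variable {E : Type*} [NormedAddCommGroup E] [NormedSpace ℂ E]

/-- The `F`-topology on `E`: the weakest topology for which all functionals in `F` are
continuous. -/
noncomputable abbrev fTop (F : Submodule ℂ (StrongDual ℂ E)) : TopologicalSpace E :=
  TopologicalSpace.induced (fun (x : E) (φ : F) => (φ : StrongDual ℂ E) x) inferInstance

/-- The `E`-topology on `F`: the topology of pointwise convergence on `E`. -/
noncomputable abbrev preTop (F : Submodule ℂ (StrongDual ℂ E)) : TopologicalSpace F :=
  TopologicalSpace.induced (fun (φ : F) (x : E) => (φ : StrongDual ℂ E) x) inferInstance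

/-- `S` is relatively compact for the topology `t`. -/
def RelCompact {T : Type*} (t : TopologicalSpace T) (S : Set T) : Prop :=
  @IsCompact T t (closure[t] S)

/-- `(E, F)` is a dual pair of Banach spaces, `F` being a space of functionals on `E` with the
dual norm. -/
structure IsDualPair (F : Submodule ℂ (StrongDual ℂ E)) : Prop where
  isClosed : IsClosed (F : Set (StrongDual ℂ E))
  norm_eq : ∀ x : E, IsLUB {r : ℝ | ∃ φ ∈ F, ‖φ‖ ≤ 1 ∧ r = ‖φ x‖} ‖x‖
  norm_dual_eq : ∀ φ ∈ F, IsLUB {r : ℝ | ∃ x : E, ‖x‖ ≤ 1 ∧ r = ‖φ x‖} ‖φ‖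
  relCompact_convexHull : ∀ K : Set E, RelCompact (fTop F) K →
    RelCompact (fTop F) (convexHull ℝ K)
  relCompact_convexHull_dual : ∀ K : Set F, RelCompact (preTop F) K →
    RelCompact (preTop F) (convexHull ℝ K)

/-- The topology on `d × d` matrices over `E` (that is, on `E ⊗ M_d(ℂ)`) given by the
functionals in `F ⊗ M_d(ℂ)^*`: entrywise convergence in the `F`-topology. -/
noncomputable abbrev fTopMat (F : Submodule ℂ (StrongDual ℂ E)) (d : ℕ) :
    TopologicalSpace (Matrix (Fin d) (Fin d) E) :=
  TopologicalSpace.induced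
    (fun (a : Matrix (Fin d) (Fin d) E) (p : F × Fin d × Fin d) =>
      (p.1 : StrongDual ℂ E) (a p.2.1 p.2.2)) inferInstance

end DualPair

section Irrep

/-- The representation on `ℂ^d` defined by a matrix-valued homomorphism. -/
noncomputable def matRep {G : Type*} [Group G] {d : ℕ}
    (u : G →* Matrix.unitaryGroup (Fin d) ℂ) : Representation ℂ G (Fin d → ℂ) :=
  ((Matrix.toLinAlgEquiv' : Matrix (Fin d) (Fin d) ℂ ≃ₐ[ℂ] _) :
      Matrix (Fin d) (Fin d) ℂ →* ((Fin d → ℂ) →ₗ[ℂ] (Fin d → ℂ))).comp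
    ((Submonoid.subtype (Matrix.unitaryGroup (Fin d) ℂ)).comp u)

/-- A continuous irreducible unitary representation of `G` on a finite-dimensional Hilbert space,
written as matrices in an orthonormal basis. -/
structure UnitaryIrrep (G : Type*) [Group G] [TopologicalSpace G] where
  dim : ℕ
  mat : G →* Matrix.unitaryGroup (Fin dim) ℂ
  continuous_mat : Continuous mat
  irreducible : (matRep mat).IsIrreducible

variable {G : Type*} [Group G] [TopologicalSpace G]

/-- The matrix coefficient `π_ij(g)`. -/
def UnitaryIrrep.coeff (π : UnitaryIrrep G) (g : G) (i j : Fin π.dim) : ℂ :=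
  (π.mat g : Matrix (Fin π.dim) (Fin π.dim) ℂ) i j

/-- Unitary equivalence: there is a unitary intertwiner `U` from `H_ρ` onto `H_π`. -/
def UnitaryIrrep.Equivalent (π ρ : UnitaryIrrep G) : Prop :=
  ∃ U : Matrix (Fin π.dim) (Fin ρ.dim) ℂ, U * U.conjTranspose = 1 ∧ U.conjTranspose * U = 1 ∧
    ∀ g, (π.mat g : Matrix (Fin π.dim) (Fin π.dim) ℂ) * U =
      U * (ρ.mat g : Matrix (Fin ρ.dim) (Fin ρ.dim) ℂ)

theorem UnitaryIrrep.equivalent_equivalence :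
    Equivalence (UnitaryIrrep.Equivalent (G := G)) where
  refl π := ⟨1, by simp, by simp, by simp⟩
  symm := by
    rintro π ρ ⟨U, h1, h2, h⟩
    refine ⟨U.conjTranspose, by simpa using h2, by simpa using h1, fun g => ?_⟩
    calc (ρ.mat g).1 * U.conjTranspose
        = (U.conjTranspose * U) * (ρ.mat g).1 * U.conjTranspose := by rw [h2, Matrix.one_mul]
      _ = U.conjTranspose * (U * (ρ.mat g).1) * U.conjTranspose := by simp only [Matrix.mul_assoc]
      _ = U.conjTranspose * (π.mat g).1 * (U * U.conjTranspose) := by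
        rw [← h g]; simp only [Matrix.mul_assoc]
      _ = U.conjTranspose * (π.mat g).1 := by rw [h1, Matrix.mul_one]
  trans := by
    rintro π ρ σ ⟨U, h1, h2, h⟩ ⟨V, k1, k2, k⟩
    refine ⟨U * V, ?_, ?_, fun g => ?_⟩
    · rw [Matrix.conjTranspose_mul, Matrix.mul_assoc, ← Matrix.mul_assoc V, k1, Matrix.one_mul, h1]
    · rw [Matrix.conjTranspose_mul, Matrix.mul_assoc, ← Matrix.mul_assoc _ U, h2, Matrix.one_mul,
        k2]
    · rw [← Matrix.mul_assoc, h g, Matrix.mul_assoc, k g, Matrix.mul_assoc]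

/-- Unitary equivalence as a setoid. -/
def UnitaryIrrep.setoid (G : Type*) [Group G] [TopologicalSpace G] : Setoid (UnitaryIrrep G) :=
  ⟨UnitaryIrrep.Equivalent, UnitaryIrrep.equivalent_equivalence⟩

/-- The dual `Ĝ`: unitary equivalence classes of irreducible representations. -/
def Dual (G : Type*) [Group G] [TopologicalSpace G] : Type _ :=
  Quotient (UnitaryIrrep.setoid G)

/-- A fixed representative of each class in `Ĝ`. -/
noncomputable def Dual.rep (π : Dual G) : UnitaryIrrep G := Quotient.out π

end Irrep

section System

variable {X : Type*} [NonUnitalCStarAlgebra X]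

/-- `(X, G, α)` is an `F`-dynamical system. -/
structure IsFDynamicalSystem {G : Type*} [Group G] [TopologicalSpace G]
    (F : Submodule ℂ (StrongDual ℂ X)) (α : G →* (X ≃⋆ₐ[ℂ] X)) : Prop where
  dualPair : IsDualPair F
  continuous_star : Continuous[fTop F, fTop F] (fun x : X => star x)
  continuous_mul_left : ∀ a : X, Continuous[fTop F, fTop F] (fun x : X => a * x)
  continuous_mul_right : ∀ a : X, Continuous[fTop F, fTop F] (fun x : X => x * a)
  continuous_aut : ∀ g : G, Continuous[fTop F, fTop F] (fun x : X => α g x)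
  continuous_orbit : ∀ x : X, ∀ φ ∈ F, Continuous (fun g : G => φ (α g x))

variable {G : Type*} [Group G] [TopologicalSpace G]

/-- The fixed point algebra `X^α`, as a subset of `X`. -/
def fixedPoints (α : G →* (X ≃⋆ₐ[ℂ] X)) : Set X := {x | ∀ g, α g x = x}

/-- For a subset `Y` of `X`, the spectral subspace `Y_2(π)` of matrices `a` with entries in `Y`
and `(α_g ⊗ ι)(a) = a (1 ⊗ π_g)` for all `g`. -/
def spectralSubspace (α : G →* (X ≃⋆ₐ[ℂ] X)) (Y : Set X) (π : UnitaryIrrep G) :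
    Set (Matrix (Fin π.dim) (Fin π.dim) X) :=
  {a | (∀ i j, a i j ∈ Y) ∧ ∀ g i j, α g (a i j) = ∑ k, π.coeff g k j • a i k}

/-- The fixed point algebra `(Y ⊗ B(H_π))^{α ⊗ ad π}`: the matrices `a` with entries in `Y` and
`(1 ⊗ π_g) [α_g(a_ij)] (1 ⊗ π_{g⁻¹}) = a` for all `g`. -/
def adFixedPoints (α : G →* (X ≃⋆ₐ[ℂ] X)) (Y : Set X) (π : UnitaryIrrep G) :
    Set (Matrix (Fin π.dim) (Fin π.dim) X) :=
  {a | (∀ i j, a i j ∈ Y) ∧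
    ∀ g i j, ∑ k, ∑ l, (π.coeff g i k * π.coeff g⁻¹ l j) • α g (a k l) = a i j}

/-- The strong Arveson spectrum of the restriction `α|_Y`, for an `F`-closed `α`-invariant
`*`-subalgebra `Y` of `X` with the `F`-topology inherited from `X`: the set of all `π` such that
the `F`-closed linear span of the products `a^* b`, `a, b ∈ Y_2(π)`, is all of
`(Y ⊗ B(H_π))^{α ⊗ ad π}`. -/
def strongArvesonSpectrum (F : Submodule ℂ (StrongDual ℂ X)) (α : G →* (X ≃⋆ₐ[ℂ] X))
    (Y : Set X) : Set (Dual G) :=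
  {π | closure[fTopMat F π.rep.dim]
      (Submodule.span ℂ {c : Matrix (Fin π.rep.dim) (Fin π.rep.dim) X |
        ∃ a ∈ spectralSubspace α Y π.rep, ∃ b ∈ spectralSubspace α Y π.rep,
          c = a.conjTranspose * b} : Set (Matrix (Fin π.rep.dim) (Fin π.rep.dim) X))
      = adFixedPoints α Y π.rep}

/-- `Y` is a non-zero globally `α`-invariant `F`-closed hereditary C*-subalgebra of `X`.
(`F`-closed subsets are norm closed.) -/
structure IsInvariantHereditary [PartialOrder X] (F : Submodule ℂ (StrongDual ℂ X))
    (α : G →* (X ≃⋆ₐ[ℂ] X)) (Y : NonUnitalStarSubalgebra ℂ X) : Prop where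
  ne_bot : ∃ y ∈ Y, y ≠ 0
  isClosed : IsClosed[fTop F] (Y : Set X)
  invariant : ∀ g, (fun x : X => α g x) '' (Y : Set X) = Y
  hereditary : ∀ x y : X, 0 ≤ x → x ≤ y → y ∈ Y → x ∈ Y

/-- The strong Connes spectrum of `α`. -/
def strongConnesSpectrum [PartialOrder X] (F : Submodule ℂ (StrongDual ℂ X))
    (α : G →* (X ≃⋆ₐ[ℂ] X)) : Set (Dual G) :=
  {π | ∀ Y : NonUnitalStarSubalgebra ℂ X, IsInvariantHereditary F α Y →
    π ∈ strongArvesonSpectrum F α (Y : Set X)}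

/-- `J` is an `F`-closed two-sided ideal of the fixed point algebra `X^α`. -/
structure IsFClosedIdeal (F : Submodule ℂ (StrongDual ℂ X)) (α : G →* (X ≃⋆ₐ[ℂ] X))
    (J : Submodule ℂ X) : Prop where
  subset : (J : Set X) ⊆ fixedPoints α
  mul_left_mem : ∀ a ∈ fixedPoints α, ∀ j ∈ J, a * j ∈ J
  mul_right_mem : ∀ a ∈ fixedPoints α, ∀ j ∈ J, j * a ∈ J
  isClosed : IsClosed[fTop F] (J : Set X)

/-- The `F`-closure of `JXJ`, the linear span of the products `j x k` with `j, k ∈ J`. -/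
def sandwich (F : Submodule ℂ (StrongDual ℂ X)) (J : Submodule ℂ X) : Set X :=
  closure[fTop F] (Submodule.span ℂ {z : X | ∃ j ∈ J, ∃ x : X, ∃ k ∈ J, z = j * x * k} : Set X)

end System

end FDyn

/-!
For an invariant hereditary subalgebra `Y`, let `J` be the `F`-closed ideal of `X^α` generated by
`Y^α = Y ∩ X^α`, and let `Z` be the `F`-closure of `JXJ`. Averaging over `G` is an `F`-continuous
conditional expectation onto `X^α`, so `Z ∩ X^α = J`. Matrices in the spectral subspaces and in the
fixed point algebra of `α ⊗ ad π` have rows and columns dominated by fixed elements; hence an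
approximate unit of `Y^α` (or of `Z^α`) is an approximate unit for them. Compressing by elements
of `Y^α` therefore carries the equality that defines the strong Arveson spectrum from `Z` down to
`Y`: in `e b* (x y x') c f` with `e, f, y ∈ Y^α` and `x, x' ∈ X^α`, replace `y` by `u y` with `u`
in an approximate unit of `Y^α` and split the product between `u` and `y`.
-/

namespace FDyn

section ApproximateUnit

open Filter

theorem mul_mul_mem_of_forall_mul_mul_star_mem {A : Type*} [NonUnitalRing A]
    [StarRing A] [Module ℂ A] [StarModule ℂ A] [IsScalarTower ℂ A A] [SMulCommClass ℂ A A]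
    {S : NonUnitalStarSubalgebra ℂ A} {x : A} (hx : ∀ a ∈ S, a * x * star a ∈ S)
    {a b : A} (ha : a ∈ S) (hb : b ∈ S) : a * x * b ∈ S := by
  have polarization : a * x * b = (1 / 4 : ℂ) • ((a + star b) * x * star (a + star b)
      - (a - star b) * x * star (a - star b)
      + Complex.I • ((a + Complex.I • star b) * x * star (a + Complex.I • star b)
      - (a - Complex.I • star b) * x * star (a - Complex.I • star b))) := by
    simp only [star_add, star_sub, star_smul, star_star, mul_add, add_mul, mul_sub, sub_mul,
      smul_mul_assoc, mul_smul_comm, smul_add, smul_sub, smul_smul, RCLike.star_def,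
      Complex.conj_I, mul_neg]
    match_scalars <;> ring_nf <;> simp only [Complex.I_sq] <;> norm_num
  have hb' := star_mem hb
  have hIb : Complex.I • star b ∈ S := SMulMemClass.smul_mem _ hb'
  rw [polarization]
  exact SMulMemClass.smul_mem _ (add_mem
    (sub_mem (hx _ (add_mem ha hb')) (hx _ (sub_mem ha hb')))
    (SMulMemClass.smul_mem _ (sub_mem (hx _ (add_mem ha hIb)) (hx _ (sub_mem ha hIb)))))

variable {X : Type*} [NonUnitalCStarAlgebra X] [PartialOrder X] [StarOrderedRing X]

theorem norm_sub_mul_self_sq_le {x h e : X} (hx : x * star x ≤ h) (he : star e = e)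
    (he1 : ‖e‖ ≤ 1) : ‖x - e * x‖ ^ 2 ≤ 2 * ‖h - e * h‖ := by
  obtain ⟨b, hb⟩ := CStarAlgebra.nonneg_iff_eq_star_mul_self.1 (sub_nonneg.2 hx)
  have compress : (h - e * h) - (h - e * h) * e - (x - e * x) * star (x - e * x)
      = star (b - b * e) * (b - b * e) := by
    have hd : h = x * star x + star b * b := by rw [← hb, add_sub_cancel]
    rw [star_sub, star_mul, star_sub, star_mul, he, hd]
    noncomm_ring
  have hle : (x - e * x) * star (x - e * x) ≤ (h - e * h) - (h - e * h) * e :=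
    sub_nonneg.1 (compress ▸ star_mul_self_nonneg _)
  calc ‖x - e * x‖ ^ 2 = ‖(x - e * x) * star (x - e * x)‖ := by
        rw [CStarRing.norm_self_mul_star, sq]
    _ ≤ ‖(h - e * h) - (h - e * h) * e‖ :=
        CStarAlgebra.norm_le_norm_of_nonneg_of_le (mul_star_self_nonneg _) hle
    _ ≤ ‖h - e * h‖ + ‖h - e * h‖ * ‖e‖ :=
        (norm_sub_le _ _).trans (add_le_add_right (norm_mul_le _ _) _)
    _ ≤ 2 * ‖h - e * h‖ := by nlinarith [norm_nonneg (h - e * h)]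

variable {S : NonUnitalStarSubalgebra ℂ X}

theorem exists_approximateUnit (hS : IsClosed (S : Set X)) :
    ∃ l : Filter S, l.NeBot ∧
      (∀ h ∈ S, ∀ x, x * star x ≤ h → Tendsto (fun e : S => (e : X) * x) l (𝓝 x)) ∧
      ∀ h ∈ S, ∀ x, star x * x ≤ h → Tendsto (fun e : S => x * e) l (𝓝 x) := by
  let _ := CStarAlgebra.spectralOrder S
  have := CStarAlgebra.spectralOrderedRing S
  let l := CStarAlgebra.approximateUnit S
  have hl := CStarAlgebra.increasingApproximateUnit S
  have hstar : ∀ᶠ e : S in l, star (e : X) = e :=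
    hl.eventually_star_eq.mono fun e he => congrArg Subtype.val he
  have left : ∀ h ∈ S, ∀ x, x * star x ≤ h → Tendsto (fun e : S => (e : X) * x) l (𝓝 x) := by
    intro h hh x hx
    have hr : Tendsto (fun e : S => 2 * ‖h - e * h‖) l (𝓝 0) := by
      have := (continuous_subtype_val.tendsto _).comp (hl.tendsto_mul_right ⟨h, hh⟩)
      simpa using ((this.const_sub h).norm).const_mul 2
    have hsq : Tendsto (fun e : S => ‖x - e * x‖ ^ 2) l (𝓝 0) :=
      squeeze_zero' (.of_forall fun e => sq_nonneg _)
        (hstar.mp (hl.eventually_norm.mono fun e he1 he =>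
          norm_sub_mul_self_sq_le hx he he1)) hr
    rw [tendsto_iff_norm_sub_tendsto_zero]
    simpa only [Real.sqrt_sq (norm_nonneg _), Real.sqrt_zero, norm_sub_rev] using hsq.sqrt
  refine ⟨l, hl.neBot, left, fun h hh x hx => ?_⟩
  have := (continuous_star.tendsto _).comp (left h hh (star x) (by rwa [star_star]))
  rw [star_star] at this
  exact this.congr' (hstar.mono fun e he => by simp [he])

theorem mem_of_nonneg_of_le (hS : IsClosed (S : Set X))
    (hSX : ∀ a ∈ S, ∀ x : X, ∀ b ∈ S, a * x * b ∈ S) {x y : X} (hx : 0 ≤ x) (hxy : x ≤ y)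
    (hy : y ∈ S) : x ∈ S := by
  have hsq : CFC.sqrt x * CFC.sqrt x = x := CFC.sqrt_mul_sqrt_self x hx
  have hsa : star (CFC.sqrt x) = CFC.sqrt x := (CFC.sqrt_nonneg x).isSelfAdjoint
  obtain ⟨l, _, hleft, hright⟩ := exists_approximateUnit hS
  have hlim := (hleft y hy (CFC.sqrt x) (by rwa [hsa, hsq])).mul
    (hright y hy (CFC.sqrt x) (by rwa [hsa, hsq]))
  rw [hsq] at hlim
  refine hS.mem_of_tendsto hlim (.of_forall fun e => ?_)
  rw [← mul_assoc, mul_assoc (e : X), hsq]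
  exact hSX e e.2 x e e.2

theorem mul_mul_mem_of_hereditary (hS : ∀ x y : X, 0 ≤ x → x ≤ y → y ∈ S → x ∈ S) {a b : X}
    (ha : a ∈ S) (x : X) (hb : b ∈ S) : a * x * b ∈ S := by
  have hx : x ∈ Submodule.span ℂ {x : X | 0 ≤ x} := by
    rw [CStarAlgebra.span_nonneg]; trivial
  induction hx using Submodule.span_induction with
  | zero => simp [zero_mem]
  | add x y _ _ hx hy => rw [mul_add, add_mul]; exact add_mem hx hy
  | smul c x _ hx => rw [mul_smul_comm, smul_mul_assoc]; exact SMulMemClass.smul_mem c hx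
  | mem x hx =>
    refine mul_mul_mem_of_forall_mul_mul_star_mem (fun a ha => ?_) ha hb
    refine hS _ (((‖x‖ : ℝ) : ℂ) • (a * star a)) (star_right_conjugate_nonneg hx a) ?_
      (SMulMemClass.smul_mem _ (mul_mem ha (star_mem ha)))
    simpa using CStarAlgebra.star_right_conjugate_le_norm_smul (a := a) (b := x) (.of_nonneg hx)

variable {m n : Type*} {a : Matrix m n X} {D : Set (Matrix m n X)}

theorem mem_of_forall_map_mul_left_mem (hS : IsClosed (S : Set X)) {h : X} (hh : h ∈ S)
    (ha : ∀ i j, a i j * star (a i j) ≤ h) (hD : IsClosed D)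
    (hmem : ∀ e ∈ S, a.map (e * ·) ∈ D) : a ∈ D := by
  obtain ⟨l, _, hl, -⟩ := exists_approximateUnit hS
  exact hD.mem_of_tendsto (f := fun e : S => a.map (e * ·)) (b := l)
    (tendsto_pi_nhds.2 fun i => tendsto_pi_nhds.2 fun j => hl h hh (a i j) (ha i j))
    (.of_forall fun e => hmem e e.2)

theorem mem_of_forall_map_mul_right_mem (hS : IsClosed (S : Set X)) {h : X} (hh : h ∈ S)
    (ha : ∀ i j, star (a i j) * a i j ≤ h) (hD : IsClosed D)
    (hmem : ∀ e ∈ S, a.map (· * e) ∈ D) : a ∈ D := by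
  obtain ⟨l, _, -, hl⟩ := exists_approximateUnit hS
  exact hD.mem_of_tendsto (f := fun e : S => a.map (· * e)) (b := l)
    (tendsto_pi_nhds.2 fun i => tendsto_pi_nhds.2 fun j => hl h hh (a i j) (ha i j))
    (.of_forall fun e => hmem e e.2)

end ApproximateUnit

section FTopology

theorem map_mem_closure_of_mem_closure_span {M N : Type*} [AddCommGroup M] [Module ℂ M]
    [TopologicalSpace M] [AddCommGroup N] [Module ℂ N] [TopologicalSpace N] [ContinuousAdd N]
    [ContinuousConstSMul ℂ N] {T : M →ₗ[ℂ] N} (hT : Continuous T) {s : Set M}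
    {V : Submodule ℂ N} (h : ∀ z ∈ s, T z ∈ closure (V : Set N)) {x : M}
    (hx : x ∈ closure (Submodule.span ℂ s : Set M)) : T x ∈ closure (V : Set N) :=
  closure_minimal (Submodule.span_le.2 h : Submodule.span ℂ s ≤ V.topologicalClosure.comap T)
    (isClosed_closure.preimage hT) hx

section NormedSpace

variable {E : Type*} [NormedAddCommGroup E] [NormedSpace ℂ E] {F : Submodule ℂ (StrongDual ℂ E)}

theorem continuous_fTop_rng {T : Type*} [TopologicalSpace T] {f : T → E} :
    Continuous[_, fTop F] f ↔ ∀ φ ∈ F, Continuous fun s => φ (f s) :=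
  continuous_induced_rng.trans <| continuous_pi_iff.trans
    ⟨fun h φ hφ => h ⟨φ, hφ⟩, fun h φ => h φ φ.2⟩

theorem continuous_fTop_apply {φ : StrongDual ℂ E} (hφ : φ ∈ F) : Continuous[fTop F, _] φ :=
  (@continuous_fTop_rng _ _ _ F E (fTop F) id).1 (@continuous_id _ (fTop F)) φ hφ

theorem le_fTop : (inferInstance : TopologicalSpace E) ≤ fTop F :=
  continuous_id_iff_le.1 (continuous_fTop_rng.2 fun φ _ => φ.continuous)

theorem isTopologicalAddGroup_fTop : @IsTopologicalAddGroup E (fTop F) _ :=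
  topologicalAddGroup_induced (LinearMap.pi fun φ : F => ((φ : StrongDual ℂ E) : E →ₗ[ℂ] ℂ))

theorem continuousSMul_fTop : @ContinuousSMul ℂ E _ _ (fTop F) :=
  continuousSMul_induced (LinearMap.pi fun φ : F => ((φ : StrongDual ℂ E) : E →ₗ[ℂ] ℂ))

theorem fTopMat_eq (d : ℕ) :
    fTopMat F d = @instTopologicalSpaceMatrix (Fin d) (Fin d) E (fTop F) := by
  change fTopMat F d = ⨅ i, .induced (fun a => a i) (⨅ j, .induced (fun v => v j) (fTop F))
  simp only [fTopMat, fTop, Pi.topologicalSpace, induced_iInf, induced_compose, iInf_prod,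
    Function.comp_def]
  rw [iInf_comm]
  exact iInf_congr fun i => iInf_comm

theorem instTopologicalSpaceMatrix_le_fTopMat (d : ℕ) :
    (inferInstance : TopologicalSpace (Matrix (Fin d) (Fin d) E)) ≤ fTopMat F d := by
  rw [fTopMat_eq]
  exact iInf_mono fun i => induced_mono (iInf_mono fun j => induced_mono le_fTop)

theorem exists_mem_eq_of_continuous_fTop (L : E →ₗ[ℂ] ℂ) (hL : Continuous[fTop F, _] L) :
    ∃ φ ∈ F, ∀ x, φ x = L x := by
  have h := (LinearMap.mem_span_iff_continuous
    (f := fun φ : F => ((φ : StrongDual ℂ E) : E →ₗ[ℂ] ℂ)) L).2 (by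
      rw [fTop, induced_to_pi] at hL
      exact hL)
  have hle : Submodule.span ℂ (Set.range fun φ : F => ((φ : StrongDual ℂ E) : E →ₗ[ℂ] ℂ)) ≤
      F.map (ContinuousLinearMap.coeLM ℂ) := by
    rw [Submodule.span_le]
    rintro _ ⟨φ, rfl⟩
    exact ⟨φ, φ.2, rfl⟩
  obtain ⟨φ, hφ, rfl⟩ := hle h
  exact ⟨φ, hφ, fun _ => rfl⟩

theorem exists_mem_eq_comp_of_continuous_fTop {T : E →ₗ[ℂ] E} (hT : Continuous[fTop F, fTop F] T)
    {φ : StrongDual ℂ E} (hφ : φ ∈ F) : ∃ ψ ∈ F, ∀ x, ψ x = φ (T x) :=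
  exists_mem_eq_of_continuous_fTop ((φ : E →ₗ[ℂ] ℂ) ∘ₗ T)
    (let _ := fTop F; (continuous_fTop_apply hφ).comp hT)

theorem IsDualPair.ext (hF : IsDualPair F) {x y : E} (h : ∀ φ ∈ F, φ x = φ y) : x = y := by
  refine sub_eq_zero.1 (norm_le_zero_iff.1 ((hF.norm_eq (x - y)).2 ?_))
  rintro _ ⟨φ, hφ, -, rfl⟩
  rw [map_sub, h φ hφ, sub_self, norm_zero]

theorem IsDualPair.t2Space (hF : IsDualPair F) : @T2Space E (fTop F) :=
  @T2Space.of_injective_continuous _ _ (fTop F) _ _ _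
    (fun _ _ h => hF.ext fun φ hφ => congrFun h ⟨φ, hφ⟩) continuous_induced_dom

end NormedSpace

variable {X : Type*} [NonUnitalCStarAlgebra X] {G : Type*} [Group G] [TopologicalSpace G]
  {F : Submodule ℂ (StrongDual ℂ X)} {α : G →* (X ≃⋆ₐ[ℂ] X)}

theorem IsFDynamicalSystem.isSemitopologicalRing (hα : IsFDynamicalSystem F α) :
    @IsSemitopologicalRing X (fTop F) _ := by
  let _ := fTop F
  have := isTopologicalAddGroup_fTop (F := F)
  exact { continuous_const_mul := fun {a} => hα.continuous_mul_left a
          continuous_mul_const := fun {a} => hα.continuous_mul_right a }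

end FTopology

section Average

open MeasureTheory

section Barycenter

variable {E : Type*} [AddCommMonoid E] [Module ℝ E] [TopologicalSpace E]
  {Ω : Type*} [TopologicalSpace Ω] [CompactSpace Ω] [MeasurableSpace Ω] [BorelSpace Ω]
  (μ : Measure Ω) [IsProbabilityMeasure μ] {f : Ω → E}

theorem integral_mem_image_closure_convexHull {V : Type*} [NormedAddCommGroup V] [NormedSpace ℝ V]
    [CompleteSpace V] (hf : Continuous f) (hK : IsCompact (closure (convexHull ℝ (Set.range f))))
    (Φ : E →L[ℝ] V) : ∫ ω, Φ (f ω) ∂μ ∈ Φ '' closure (convexHull ℝ (Set.range f)) := by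
  have hint : Integrable (fun ω => Φ (f ω)) μ :=
    (Φ.continuous.comp hf).integrable_of_hasCompactSupport (.of_compactSpace _)
  have hmem : ∫ ω, Φ (f ω) ∂μ ∈ closure (convexHull ℝ (Set.range fun ω => Φ (f ω))) :=
    (convex_convexHull ℝ _).closure.integral_mem isClosed_closure
      (.of_forall fun ω => subset_closure (subset_convexHull ℝ _ (Set.mem_range_self ω))) hint
  refine closure_minimal ?_ (hK.image Φ.continuous).isClosed hmem
  have hrange : (Set.range fun ω => Φ (f ω)) = (Φ : E →ₗ[ℝ] V) '' Set.range f := Set.range_comp Φ f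
  rw [hrange, ← LinearMap.image_convexHull]
  exact Set.image_mono subset_closure

theorem exists_barycenter (hf : Continuous f)
    (hK : IsCompact (closure (convexHull ℝ (Set.range f)))) :
    ∃ p, ∀ L : E →L[ℝ] ℂ, L p = ∫ ω, L (f ω) ∂μ := by
  have finite_inter : ∀ u : Finset (E →L[ℝ] ℂ), (closure (convexHull ℝ (Set.range f)) ∩
      ⋂ L ∈ u, {p | L p = ∫ ω, L (f ω) ∂μ}).Nonempty := by
    intro u
    let Φ : E →L[ℝ] (u → ℂ) := .pi fun L => L
    obtain ⟨p, hp, hpΦ⟩ := integral_mem_image_closure_convexHull μ hf hK Φ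
    have hint : ∀ L : u, Integrable (fun ω => Φ (f ω) L) μ := fun L =>
      (L.1.continuous.comp hf).integrable_of_hasCompactSupport (.of_compactSpace _)
    exact ⟨p, hp, Set.mem_iInter₂.2 fun L hL =>
      (congrFun hpΦ ⟨L, hL⟩).trans (eval_integral hint ⟨L, hL⟩)⟩
  obtain ⟨p, -, hp⟩ := hK.inter_iInter_nonempty _
    (fun L : E →L[ℝ] ℂ => isClosed_eq L.continuous continuous_const) finite_inter
  exact ⟨p, Set.mem_iInter.1 hp⟩

end Barycenter

section DualPair

variable {E : Type*} [NormedAddCommGroup E] [NormedSpace ℂ E] {F : Submodule ℂ (StrongDual ℂ E)}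
  {Ω : Type*} [TopologicalSpace Ω] [CompactSpace Ω] [MeasurableSpace Ω] [BorelSpace Ω]
  (μ : Measure Ω) [IsProbabilityMeasure μ]

theorem IsDualPair.exists_integral (hF : IsDualPair F) {f : Ω → E}
    (hf : Continuous[_, fTop F] f) : ∃ p, ∀ φ ∈ F, φ p = ∫ ω, φ (f ω) ∂μ := by
  let _ := fTop F
  have := hF.t2Space
  obtain ⟨p, hp⟩ := exists_barycenter μ hf
    (hF.relCompact_convexHull _ (isCompact_range hf).closure)
  exact ⟨p, fun φ hφ => hp ⟨(φ : E →ₗ[ℂ] ℂ).restrictScalars ℝ, continuous_fTop_apply hφ⟩⟩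

theorem IsDualPair.exists_integral_dual (hF : IsDualPair F) {f : Ω → StrongDual ℂ E}
    (hfF : ∀ ω, f ω ∈ F) (hf : ∀ x, Continuous fun ω => f ω x) :
    ∃ ψ ∈ F, ∀ x, ψ x = ∫ ω, f ω x ∂μ := by
  let _ := preTop F
  have : T2Space F := .of_injective_continuous
    (fun φ ψ h => Subtype.ext (ContinuousLinearMap.ext fun x => congrFun h x))
    continuous_induced_dom
  have hf' : Continuous (fun ω => (⟨f ω, hfF ω⟩ : F)) :=
    continuous_induced_rng.2 (continuous_pi hf)
  have hK := hF.relCompact_convexHull_dual _ (isCompact_range hf').closure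
  obtain ⟨ψ, hψ⟩ := exists_barycenter μ hf' hK
  refine ⟨ψ, ψ.2, fun x => ?_⟩
  let evalAt : F →ₗ[ℂ] ℂ := (ContinuousLinearMap.apply ℂ ℂ x).toLinearMap ∘ₗ F.subtype
  have hevalAt : Continuous evalAt := (continuous_apply x).comp
    (continuous_induced_dom (f := fun (φ : F) (x : E) => (φ : StrongDual ℂ E) x))
  exact hψ ⟨evalAt.restrictScalars ℝ, hevalAt⟩

end DualPair

variable {X : Type*} [NonUnitalCStarAlgebra X] {G : Type*} [Group G]
  {F : Submodule ℂ (StrongDual ℂ X)} {α : G →* (X ≃⋆ₐ[ℂ] X)}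

/-- `P` is the weak average of the orbit maps `g ↦ α_g(x)` against the measure `μ`. -/
def IsAverage [MeasurableSpace G] (F : Submodule ℂ (StrongDual ℂ X)) (α : G →* (X ≃⋆ₐ[ℂ] X))
    (μ : Measure G) (P : X →ₗ[ℂ] X) : Prop :=
  ∀ x, ∀ φ ∈ F, φ (P x) = ∫ g, φ (α g x) ∂μ

variable [TopologicalSpace G]

theorem IsFDynamicalSystem.exists_mem_eq_comp_aut (hα : IsFDynamicalSystem F α) (g : G)
    {φ : StrongDual ℂ X} (hφ : φ ∈ F) : ∃ ψ ∈ F, ∀ x, ψ x = φ (α g x) :=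
  exists_mem_eq_comp_of_continuous_fTop
    (T := ((α g : X →⋆ₙₐ[ℂ] X) : X →ₗ[ℂ] X)) (hα.continuous_aut g) hφ

namespace IsAverage

variable [MeasurableSpace G] {μ : Measure G} {P : X →ₗ[ℂ] X}

theorem map_mem_fixedPoints [BorelSpace G] [IsTopologicalGroup G] [μ.IsMulLeftInvariant]
    (hP : IsAverage F α μ P) (hα : IsFDynamicalSystem F α) (x : X) : P x ∈ fixedPoints α := by
  refine fun h => hα.dualPair.ext fun φ hφ => ?_
  obtain ⟨ψ, hψ, hψφ⟩ := hα.exists_mem_eq_comp_aut h hφ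
  rw [← hψφ, hP x ψ hψ, hP x φ hφ, ← integral_mul_left_eq_self (fun g => φ (α g x)) h]
  simp only [hψφ, map_mul, StarAlgEquiv.mul_apply]

theorem map_eq_self [IsProbabilityMeasure μ] (hP : IsAverage F α μ P)
    (hα : IsFDynamicalSystem F α) {x : X} (hx : x ∈ fixedPoints α) : P x = x := by
  refine hα.dualPair.ext fun φ hφ => ?_
  simp only [hP x φ hφ, hx _, integral_const, probReal_univ, one_smul]

theorem map_mul_mul (hP : IsAverage F α μ P) (hα : IsFDynamicalSystem F α) {a b : X}
    (ha : a ∈ fixedPoints α) (hb : b ∈ fixedPoints α) (x : X) : P (a * x * b) = a * P x * b := by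
  refine hα.dualPair.ext fun φ hφ => ?_
  obtain ⟨ψ, hψ, hψφ⟩ := exists_mem_eq_comp_of_continuous_fTop
    (T := LinearMap.mulRight ℂ b ∘ₗ LinearMap.mulLeft ℂ a) (by
      let _ := fTop F
      exact (hα.continuous_mul_right b).comp (hα.continuous_mul_left a)) hφ
  calc φ (P (a * x * b)) = ∫ g, φ (α g (a * x * b)) ∂μ := hP _ φ hφ
    _ = ∫ g, ψ (α g x) ∂μ := by simp [hψφ, ha _, hb _]
    _ = φ (a * P x * b) := by rw [← hP x ψ hψ, hψφ]; rfl

variable [CompactSpace G] [BorelSpace G]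

theorem continuous [IsProbabilityMeasure μ] (hP : IsAverage F α μ P)
    (hα : IsFDynamicalSystem F α) : Continuous[fTop F, fTop F] P := by
  let _ := fTop F
  refine continuous_fTop_rng.2 fun φ hφ => ?_
  choose ψ hψ hψφ using fun g => hα.exists_mem_eq_comp_aut g hφ
  obtain ⟨p, hp, hpψ⟩ := hα.dualPair.exists_integral_dual μ hψ fun x =>
    (hα.continuous_orbit x φ hφ).congr fun g => (hψφ g x).symm
  refine (continuous_fTop_apply hp).congr fun x => ?_
  simp only [hpψ, hψφ, hP x φ hφ]

end IsAverage

variable [CompactSpace G]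

section

variable [MeasurableSpace G] [BorelSpace G] {μ : Measure G}

theorem IsFDynamicalSystem.integrable_orbit [IsFiniteMeasure μ] (hα : IsFDynamicalSystem F α)
    (x : X) {φ : StrongDual ℂ X} (hφ : φ ∈ F) : Integrable (fun g => φ (α g x)) μ :=
  (hα.continuous_orbit x φ hφ).integrable_of_hasCompactSupport (.of_compactSpace _)

theorem IsFDynamicalSystem.exists_isAverage (hα : IsFDynamicalSystem F α) (μ : Measure G)
    [IsProbabilityMeasure μ] : ∃ P, IsAverage F α μ P := by
  choose p hp using fun x =>
    hα.dualPair.exists_integral μ (continuous_fTop_rng.2 (hα.continuous_orbit x))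
  refine ⟨{ toFun := p, map_add' := fun x y => ?_, map_smul' := fun c x => ?_ }, hp⟩
  · refine hα.dualPair.ext fun φ hφ => ?_
    simp only [map_add, hp _ φ hφ,
      integral_add (hα.integrable_orbit x hφ) (hα.integrable_orbit y hφ)]
  · refine hα.dualPair.ext fun φ hφ => ?_
    simp only [map_smul, hp _ φ hφ, integral_smul, RingHom.id_apply]

end

theorem IsFDynamicalSystem.exists_projection [IsTopologicalGroup G] (hα : IsFDynamicalSystem F α) :
    ∃ P : X →ₗ[ℂ] X, Continuous[fTop F, fTop F] P ∧ (∀ x, P x ∈ fixedPoints α) ∧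
      (∀ x ∈ fixedPoints α, P x = x) ∧
      ∀ a ∈ fixedPoints α, ∀ b ∈ fixedPoints α, ∀ x, P (a * x * b) = a * P x * b := by
  let _ : MeasurableSpace G := borel G
  have : BorelSpace G := ⟨rfl⟩
  let μ : Measure G := Measure.haarMeasure ⊤
  have : IsProbabilityMeasure μ := ⟨Measure.haarMeasure_self (K₀ := ⊤)⟩
  obtain ⟨P, hP⟩ := hα.exists_isAverage μ
  exact ⟨P, hP.continuous hα, hP.map_mem_fixedPoints hα, fun x hx => hP.map_eq_self hα hx,
    fun a ha b hb x => hP.map_mul_mul hα ha hb x⟩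

end Average

section FixedPoints

variable {X : Type*} [NonUnitalCStarAlgebra X] {G : Type*} [Group G]
  {F : Submodule ℂ (StrongDual ℂ X)} {α : G →* (X ≃⋆ₐ[ℂ] X)}

/-- The fixed point algebra `X^α` as a `*`-subalgebra of `X`. -/
def fixedSubalgebra (α : G →* (X ≃⋆ₐ[ℂ] X)) : NonUnitalStarSubalgebra ℂ X where
  carrier := fixedPoints α
  add_mem' ha hb g := by rw [map_add, ha g, hb g]
  zero_mem' g := map_zero _
  mul_mem' ha hb g := by rw [map_mul, ha g, hb g]
  smul_mem' c x hx g := by rw [map_smul, hx g]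
  star_mem' ha g := by rw [map_star, ha g]

theorem IsFDynamicalSystem.isClosed_fixedSubalgebra [TopologicalSpace G]
    (hα : IsFDynamicalSystem F α) : IsClosed[fTop F] (fixedSubalgebra α : Set X) := by
  let _ := fTop F
  have := hα.dualPair.t2Space
  change IsClosed {x | ∀ g, α g x = x}
  rw [Set.ofPred_forall]
  exact isClosed_iInter fun g => isClosed_eq (hα.continuous_aut g) continuous_id

theorem sum_mul_star_mem_fixedSubalgebra {ι : Type*} [Fintype ι] [DecidableEq ι] {c : ι → X}
    {u : G → Matrix ι ι ℂ} (hu : ∀ g, u g ∈ Matrix.unitaryGroup ι ℂ)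
    (hc : ∀ g i, α g (c i) = ∑ k, u g i k • c k) : ∑ i, c i * star (c i) ∈ fixedSubalgebra α := by
  intro g
  calc α g (∑ i, c i * star (c i))
      = ∑ k, ∑ l, ∑ i, (u g i k * star (u g i l)) • (c k * star (c l)) := by
        simp only [map_sum, map_mul, map_star, hc, star_sum, star_smul, Finset.sum_mul_sum,
          smul_mul_smul_comm]
        rw [Finset.sum_comm_cycle, Finset.sum_comm_cycle]
    _ = ∑ k, ∑ l, (star (u g) * u g) l k • (c k * star (c l)) := by
        simp only [Matrix.mul_apply, Finset.sum_smul, Matrix.star_apply, mul_comm]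
    _ = ∑ i, c i * star (c i) := by
        simp [Matrix.mem_unitaryGroup_iff'.1 (hu g), Matrix.one_apply]

/-- The `F`-closed two-sided ideal of `X^α` generated by `Y ∩ X^α`. -/
noncomputable def fixedIdeal (F : Submodule ℂ (StrongDual ℂ X)) (α : G →* (X ≃⋆ₐ[ℂ] X))
    (Y : NonUnitalStarSubalgebra ℂ X) : Submodule ℂ X :=
  let _ := fTop F
  have := isTopologicalAddGroup_fTop (F := F)
  have := continuousSMul_fTop (F := F)
  (Submodule.span ℂ {z | ∃ a ∈ fixedSubalgebra α, ∃ y ∈ Y ⊓ fixedSubalgebra α,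
    ∃ b ∈ fixedSubalgebra α, z = a * y * b}).topologicalClosure

theorem mul_mul_mem_fixedIdeal {Y : NonUnitalStarSubalgebra ℂ X} {a y b : X}
    (ha : a ∈ fixedSubalgebra α) (hy : y ∈ Y ⊓ fixedSubalgebra α) (hb : b ∈ fixedSubalgebra α) :
    a * y * b ∈ fixedIdeal F α Y :=
  let _ := fTop F
  subset_closure (Submodule.subset_span ⟨a, ha, y, hy, b, hb, rfl⟩)

theorem IsFDynamicalSystem.isFClosedIdeal_fixedIdeal [TopologicalSpace G]
    (hα : IsFDynamicalSystem F α) (Y : NonUnitalStarSubalgebra ℂ X) :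
    IsFClosedIdeal F α (fixedIdeal F α Y) := by
  let _ := fTop F
  have := isTopologicalAddGroup_fTop (F := F)
  have := continuousSMul_fTop (F := F)
  refine ⟨fun x hx => ?_, fun c hc x hx => ?_, fun c hc x hx => ?_, isClosed_closure⟩
  · refine closure_minimal (Submodule.span_le (p := (fixedSubalgebra α).toSubmodule).2 ?_)
      hα.isClosed_fixedSubalgebra hx
    rintro _ ⟨a, ha, y, hy, b, hb, rfl⟩
    exact mul_mem (S := NonUnitalStarSubalgebra ℂ X) (mul_mem ha hy.2) hb
  · refine map_mem_closure_of_mem_closure_span (T := LinearMap.mulLeft ℂ c)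
      (hα.continuous_mul_left c) ?_ hx
    rintro _ ⟨a, ha, y, hy, b, hb, rfl⟩
    rw [LinearMap.mulLeft_apply, ← mul_assoc, ← mul_assoc]
    exact mul_mul_mem_fixedIdeal (mul_mem hc ha) hy hb
  · refine map_mem_closure_of_mem_closure_span (T := LinearMap.mulRight ℂ c)
      (hα.continuous_mul_right c) ?_ hx
    rintro _ ⟨a, ha, y, hy, b, hb, rfl⟩
    rw [LinearMap.mulRight_apply, mul_assoc]
    exact mul_mul_mem_fixedIdeal ha hy (mul_mem hb hc)

variable [PartialOrder X] [StarOrderedRing X]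

theorem exists_mul_star_le {Y : NonUnitalStarSubalgebra ℂ X} {d : ℕ}
    {a : Matrix (Fin d) (Fin d) X} (haY : ∀ i j, a i j ∈ Y)
    (v w : G → Matrix.unitaryGroup (Fin d) ℂ)
    (ha : ∀ g i j, α g (a i j) = ∑ k, ∑ l, ((v g).1 i k * (w g).1 l j) • a k l) :
    ∃ h ∈ Y ⊓ fixedSubalgebra α, ∀ i j, a i j * star (a i j) ≤ h := by
  refine ⟨∑ p : Fin d × Fin d, a p.1 p.2 * star (a p.1 p.2),
    ⟨sum_mem fun p _ => mul_mem (haY _ _) (star_mem (haY _ _)), ?_⟩, fun i j =>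
      Finset.single_le_sum (f := fun p : Fin d × Fin d => a p.1 p.2 * star (a p.1 p.2))
        (fun p _ => mul_star_self_nonneg _) (Finset.mem_univ (i, j))⟩
  refine sum_mul_star_mem_fixedSubalgebra (c := fun p : Fin d × Fin d => a p.1 p.2)
    (u := fun g => Matrix.kronecker (v g).1 (w g).1.transpose)
    (fun g => Matrix.kronecker_mem_unitary (v g).2
      (Matrix.transpose_mem_unitaryGroup_iff.2 (w g).2)) fun g p => ?_
  rw [ha, Fintype.sum_prod_type]
  rfl

theorem mem_fixedIdeal {Y : NonUnitalStarSubalgebra ℂ X}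
    (hY : IsClosed ((Y ⊓ fixedSubalgebra α : NonUnitalStarSubalgebra ℂ X) : Set X)) {y : X}
    (hy : y ∈ Y ⊓ fixedSubalgebra α) : y ∈ fixedIdeal F α Y := by
  have hJ : IsClosed (fixedIdeal F α Y : Set X) :=
    (let _ := fTop F; isClosed_closure : IsClosed[fTop F] _).mono le_fTop
  obtain ⟨l, _, hleft, hright⟩ := exists_approximateUnit hY
  have mul_mem_fixedIdeal : ∀ e ∈ Y ⊓ fixedSubalgebra α, e * y ∈ fixedIdeal F α Y := fun e he =>
    have hey := mul_mem he hy
    hJ.mem_of_tendsto (hright _ (mul_mem (star_mem hey) hey) (e * y) le_rfl)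
      (.of_forall fun f => mul_mul_mem_fixedIdeal he.2 hy f.2.2)
  exact hJ.mem_of_tendsto (hleft _ (mul_mem hy (star_mem hy)) y le_rfl)
    (.of_forall fun e => mul_mem_fixedIdeal e e.2)

theorem IsFClosedIdeal.star_mem {J : Submodule ℂ X} (hJ : IsFClosedIdeal F α J) {j : X}
    (hj : j ∈ J) : star j ∈ J := by
  have hcl : IsClosed (J : Set X) := hJ.isClosed.mono le_fTop
  let S : NonUnitalStarSubalgebra ℂ X :=
    { carrier := {x | x ∈ J ∧ star x ∈ J}
      add_mem' := fun ha hb => ⟨add_mem ha.1 hb.1, by rw [star_add]; exact add_mem ha.2 hb.2⟩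
      zero_mem' := ⟨zero_mem _, by rw [star_zero]; exact zero_mem _⟩
      mul_mem' := fun ha hb => ⟨hJ.mul_left_mem _ (hJ.subset ha.1) _ hb.1, by
        rw [star_mul]; exact hJ.mul_left_mem _ (hJ.subset hb.2) _ ha.2⟩
      smul_mem' := fun c x hx => ⟨J.smul_mem c hx.1, by
        rw [star_smul]; exact J.smul_mem _ hx.2⟩
      star_mem' := fun hx => ⟨hx.2, by rw [star_star]; exact hx.1⟩ }
  have hS : IsClosed (S : Set X) := hcl.inter (hcl.preimage continuous_star)
  have hj' : star j ∈ fixedPoints α := (fixedSubalgebra α).star_mem' (hJ.subset hj)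
  have hjj : j * star j ∈ S :=
    ⟨hJ.mul_right_mem _ hj' _ hj, by
      rw [star_mul, star_star]; exact hJ.mul_right_mem _ hj' _ hj⟩
  obtain ⟨l, _, -, hright⟩ := exists_approximateUnit hS
  exact hcl.mem_of_tendsto (hright _ hjj (star j) (by rw [star_star]))
    (.of_forall fun e => hJ.mul_left_mem _ hj' _ e.2.1)

end FixedPoints

section Sandwich

variable {X : Type*} [NonUnitalCStarAlgebra X] {G : Type*} [Group G] [TopologicalSpace G]
  {F : Submodule ℂ (StrongDual ℂ X)} {α : G →* (X ≃⋆ₐ[ℂ] X)} {J : Submodule ℂ X}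

theorem mul_mul_mem_sandwich_of_mem {j k : X} (hj : j ∈ J) (x : X) (hk : k ∈ J) :
    j * x * k ∈ sandwich F J :=
  let _ := fTop F
  subset_closure (Submodule.subset_span ⟨j, hj, x, k, hk, rfl⟩)

theorem map_mem_sandwich {T : X →ₗ[ℂ] X} (hT : Continuous[fTop F, fTop F] T)
    (h : ∀ j ∈ J, ∀ x, ∀ k ∈ J, T (j * x * k) ∈ sandwich F J) {x : X} (hx : x ∈ sandwich F J) :
    T x ∈ sandwich F J := by
  let _ := fTop F
  have := isTopologicalAddGroup_fTop (F := F)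
  have := continuousSMul_fTop (F := F)
  refine map_mem_closure_of_mem_closure_span hT ?_ hx
  rintro _ ⟨j, hj, x, k, hk, rfl⟩
  exact h j hj x k hk

namespace IsFDynamicalSystem

theorem mul_mul_mem_sandwich_of_mem_left (hα : IsFDynamicalSystem F α) {j y : X} (hj : j ∈ J)
    (x : X) (hy : y ∈ sandwich F J) : j * x * y ∈ sandwich F J := by
  refine map_mem_sandwich (T := LinearMap.mulLeft ℂ (j * x)) (hα.continuous_mul_left _)
    (fun j' _ x' k' hk' => ?_) hy
  simpa only [LinearMap.mulLeft_apply, mul_assoc] using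
    mul_mul_mem_sandwich_of_mem hj (x * j' * x') hk'

theorem mul_mem_sandwich (hα : IsFDynamicalSystem F α) {x y : X} (hx : x ∈ sandwich F J)
    (hy : y ∈ sandwich F J) : x * y ∈ sandwich F J := by
  refine map_mem_sandwich (T := LinearMap.mulRight ℂ y) (hα.continuous_mul_right y)
    (fun j hj x' k _ => ?_) hx
  rw [LinearMap.mulRight_apply, mul_assoc j]
  exact hα.mul_mul_mem_sandwich_of_mem_left hj _ hy

theorem mul_mul_mem_sandwich (hα : IsFDynamicalSystem F α) {x y : X} (hx : x ∈ sandwich F J)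
    (w : X) (hy : y ∈ sandwich F J) : x * w * y ∈ sandwich F J := by
  rw [mul_assoc]
  refine map_mem_sandwich (T := LinearMap.mulRight ℂ (w * y)) (hα.continuous_mul_right _)
    (fun j hj x' k _ => ?_) hx
  rw [LinearMap.mulRight_apply, ← mul_assoc, mul_assoc j, mul_assoc j]
  exact hα.mul_mul_mem_sandwich_of_mem_left hj _ hy

theorem aut_mem_sandwich (hα : IsFDynamicalSystem F α) (hJ : (J : Set X) ⊆ fixedPoints α) (g : G)
    {x : X} (hx : x ∈ sandwich F J) : α g x ∈ sandwich F J := by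
  refine map_mem_sandwich (T := ((α g : X →⋆ₙₐ[ℂ] X) : X →ₗ[ℂ] X)) (hα.continuous_aut g)
    (fun j hj x k hk => ?_) hx
  change α g (j * x * k) ∈ _
  rw [map_mul, map_mul, hJ hj g, hJ hk g]
  exact mul_mul_mem_sandwich_of_mem hj _ hk

theorem star_mem_sandwich (hα : IsFDynamicalSystem F α) (hJ : ∀ j ∈ J, star j ∈ J) {x : X}
    (hx : x ∈ sandwich F J) : star x ∈ sandwich F J := by
  let _ := fTop F
  refine map_mem_closure hα.continuous_star hx fun z hz => ?_
  induction hz using Submodule.span_induction with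
  | zero => rw [star_zero]; exact zero_mem _
  | add x y _ _ hx hy => rw [star_add]; exact add_mem hx hy
  | smul c x _ hx => rw [star_smul]; exact Submodule.smul_mem _ _ hx
  | mem z hz =>
    obtain ⟨j, hj, x, k, hk, rfl⟩ := hz
    rw [star_mul, star_mul, ← mul_assoc]
    exact Submodule.subset_span ⟨_, hJ k hk, _, _, hJ j hj, rfl⟩

theorem mem_of_mem_sandwich [IsTopologicalGroup G] [CompactSpace G]
    (hα : IsFDynamicalSystem F α) (hJ : IsFClosedIdeal F α J) {z : X} (hz : z ∈ sandwich F J)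
    (hzα : z ∈ fixedPoints α) : z ∈ J := by
  obtain ⟨P, hP, hfix, hid, hmul⟩ := hα.exists_projection
  let _ := fTop F
  rw [← hid z hzα]
  refine closure_minimal (Submodule.span_le (p := J.comap P).2 ?_) (hJ.isClosed.preimage hP) hz
  rintro _ ⟨j, hj, x, k, hk, rfl⟩
  rw [SetLike.mem_coe, Submodule.mem_comap, hmul j (hJ.subset hj) k (hJ.subset hk), mul_assoc]
  exact hJ.mul_right_mem _ (mul_mem (s := fixedSubalgebra α) (hfix x) (hJ.subset hk)) _ hj

variable [PartialOrder X] [StarOrderedRing X]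

/-- The hereditary subalgebra generated by an `F`-closed ideal `J` of `X^α`: the set
`sandwich F J` as a `*`-subalgebra of `X`. -/
noncomputable def sandwichAlgebra (hα : IsFDynamicalSystem F α) (hJ : IsFClosedIdeal F α J) :
    NonUnitalStarSubalgebra ℂ X :=
  let _ := fTop F
  have := isTopologicalAddGroup_fTop (F := F)
  have := continuousSMul_fTop (F := F)
  { (Submodule.span ℂ {z : X | ∃ j ∈ J, ∃ x : X, ∃ k ∈ J, z = j * x * k}).topologicalClosure with
    mul_mem' := hα.mul_mem_sandwich
    star_mem' := hα.star_mem_sandwich fun _ => hJ.star_mem }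

theorem coe_sandwichAlgebra (hα : IsFDynamicalSystem F α) (hJ : IsFClosedIdeal F α J) :
    (hα.sandwichAlgebra hJ : Set X) = sandwich F J := rfl

theorem isClosed_sandwichAlgebra (hα : IsFDynamicalSystem F α) (hJ : IsFClosedIdeal F α J) :
    IsClosed[fTop F] (hα.sandwichAlgebra hJ : Set X) :=
  let _ := fTop F
  isClosed_closure

theorem image_aut_sandwichAlgebra (hα : IsFDynamicalSystem F α) (hJ : IsFClosedIdeal F α J)
    (g : G) : (fun x => α g x) '' (hα.sandwichAlgebra hJ : Set X) = hα.sandwichAlgebra hJ :=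
  Set.Subset.antisymm (Set.image_subset_iff.2 fun _ => hα.aut_mem_sandwich hJ.subset g)
    fun x hx => ⟨α g⁻¹ x, hα.aut_mem_sandwich hJ.subset g⁻¹ hx, by
      simp [← StarAlgEquiv.mul_apply]⟩

theorem isInvariantHereditary_sandwichAlgebra (hα : IsFDynamicalSystem F α)
    (hJ : IsFClosedIdeal F α J) (hne : ∃ z ∈ hα.sandwichAlgebra hJ, z ≠ 0) :
    IsInvariantHereditary F α (hα.sandwichAlgebra hJ) where
  ne_bot := hne
  isClosed := hα.isClosed_sandwichAlgebra hJ
  invariant := hα.image_aut_sandwichAlgebra hJ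
  hereditary _ _ hx hxy hy := mem_of_nonneg_of_le
    ((hα.isClosed_sandwichAlgebra hJ).mono le_fTop)
    (fun _ ha w _ hb => hα.mul_mul_mem_sandwich ha w hb) hx hxy hy

end IsFDynamicalSystem

end Sandwich

section Spectral

variable {X : Type*} [NonUnitalCStarAlgebra X] {G : Type*} [Group G] [TopologicalSpace G]
  {F : Submodule ℂ (StrongDual ℂ X)} {α : G →* (X ≃⋆ₐ[ℂ] X)} {π : UnitaryIrrep G}

/-- The linear span of the products `a^* b` with `a, b ∈ Y_2(π)`. -/
def spectralSpan (α : G →* (X ≃⋆ₐ[ℂ] X)) (Y : Set X) (π : UnitaryIrrep G) :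
    Submodule ℂ (Matrix (Fin π.dim) (Fin π.dim) X) :=
  Submodule.span ℂ {c | ∃ a ∈ spectralSubspace α Y π, ∃ b ∈ spectralSubspace α Y π,
    c = a.conjTranspose * b}

theorem UnitaryIrrep.coeff_inv (π : UnitaryIrrep G) (g : G) (i j : Fin π.dim) :
    π.coeff g⁻¹ i j = star (π.coeff g j i) := by
  rw [coeff, map_inv]
  rfl

theorem sum_smul_aut_of_mem_spectralSubspace {Y : Set X} {a : Matrix (Fin π.dim) (Fin π.dim) X}
    (ha : a ∈ spectralSubspace α Y π) (g : G) (i j : Fin π.dim) :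
    ∑ k, π.coeff g⁻¹ k j • α g (a i k) = a i j := by
  have h := congrArg (α g) (ha.2 g⁻¹ i j)
  simpa only [map_sum, map_smul, ← StarAlgEquiv.mul_apply, ← map_mul, mul_inv_cancel, map_one,
    StarAlgEquiv.one_apply] using h.symm

theorem aut_apply_of_mem_adFixedPoints {Y : Set X} {a : Matrix (Fin π.dim) (Fin π.dim) X}
    (ha : a ∈ adFixedPoints α Y π) (g : G) (i j : Fin π.dim) :
    α g (a i j) = ∑ k, ∑ l, (π.coeff g⁻¹ i k * π.coeff g l j) • a k l := by
  have h := congrArg (α g) (ha.2 g⁻¹ i j)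
  simpa only [map_sum, map_smul, ← StarAlgEquiv.mul_apply, ← map_mul, mul_inv_cancel, map_one,
    StarAlgEquiv.one_apply, inv_inv] using h.symm

theorem conjTranspose_mem_adFixedPoints {Y : NonUnitalStarSubalgebra ℂ X}
    {a : Matrix (Fin π.dim) (Fin π.dim) X} (ha : a ∈ adFixedPoints α (Y : Set X) π) :
    a.conjTranspose ∈ adFixedPoints α (Y : Set X) π := by
  refine ⟨fun i j => star_mem (ha.1 j i), fun g i j => ?_⟩
  rw [Matrix.conjTranspose_apply, ← ha.2 g j i, Finset.sum_comm]
  simp only [star_sum, star_smul, star_mul', ← map_star, ← UnitaryIrrep.coeff_inv, inv_inv,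
    Matrix.conjTranspose_apply, mul_comm]

theorem conjTranspose_mul_mem_adFixedPoints {Y : NonUnitalStarSubalgebra ℂ X}
    {a b : Matrix (Fin π.dim) (Fin π.dim) X} (ha : a ∈ spectralSubspace α (Y : Set X) π)
    (hb : b ∈ spectralSubspace α (Y : Set X) π) :
    a.conjTranspose * b ∈ adFixedPoints α (Y : Set X) π := by
  refine ⟨fun i j => ?_, fun g i j => ?_⟩
  · rw [SetLike.mem_coe, Matrix.mul_apply]
    exact sum_mem fun k _ => mul_mem (star_mem (ha.1 k i)) (hb.1 k j)
  have star_row : ∀ m, ∑ k, π.coeff g i k • star (α g (a m k)) = star (a m i) := fun m => by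
    simp only [← sum_smul_aut_of_mem_spectralSubspace ha g m i, star_sum, star_smul,
      ← UnitaryIrrep.coeff_inv, inv_inv]
  calc ∑ k, ∑ l, (π.coeff g i k * π.coeff g⁻¹ l j) • α g (∑ m, star (a m k) * b m l)
      = ∑ k, ∑ l, ∑ m, (π.coeff g i k • star (α g (a m k))) * (π.coeff g⁻¹ l j • α g (b m l)) := by
        simp only [map_sum, map_mul, map_star, Finset.smul_sum, smul_mul_smul_comm]
    _ = ∑ m, (∑ k, π.coeff g i k • star (α g (a m k))) * ∑ l, π.coeff g⁻¹ l j • α g (b m l) := by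
        simp only [Finset.sum_mul_sum]
        rw [Finset.sum_comm_cycle]
    _ = ∑ m, star (a m i) * b m j := by
        simp only [star_row, sum_smul_aut_of_mem_spectralSubspace hb]

theorem spectralSpan_subset_adFixedPoints {Y : NonUnitalStarSubalgebra ℂ X} :
    (spectralSpan α (Y : Set X) π : Set (Matrix (Fin π.dim) (Fin π.dim) X)) ⊆
      adFixedPoints α (Y : Set X) π := by
  intro c hc
  induction hc using Submodule.span_induction with
  | zero => exact ⟨fun _ _ => zero_mem Y, fun g i j => by simp⟩
  | add a b _ _ ha hb =>
    refine ⟨fun i j => add_mem (ha.1 i j) (hb.1 i j), fun g i j => ?_⟩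
    simp only [Matrix.add_apply, map_add, smul_add, Finset.sum_add_distrib, ha.2, hb.2]
  | smul c a _ ha =>
    refine ⟨fun i j => SMulMemClass.smul_mem c (ha.1 i j), fun g i j => ?_⟩
    simp only [Matrix.smul_apply, map_smul, smul_comm _ c, ← Finset.smul_sum, ha.2]
  | mem c hc =>
    obtain ⟨a, ha, b, hb, rfl⟩ := hc
    exact conjTranspose_mul_mem_adFixedPoints ha hb

namespace IsFDynamicalSystem

theorem isClosed_adFixedPoints (hα : IsFDynamicalSystem F α) {Y : Set X}
    (hY : IsClosed[fTop F] Y) : IsClosed[fTopMat F π.dim] (adFixedPoints α Y π) := by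
  rw [fTopMat_eq]
  let _ := fTop F
  have := hα.dualPair.t2Space
  have := isTopologicalAddGroup_fTop (F := F)
  have := continuousSMul_fTop (F := F)
  have hαc := hα.continuous_aut
  simp only [adFixedPoints, Set.ofPred_and, Set.ofPred_forall]
  exact (isClosed_iInter fun i => isClosed_iInter fun j => hY.preimage (by fun_prop)).inter
    (isClosed_iInter fun g => isClosed_iInter fun i => isClosed_iInter fun j =>
      isClosed_eq (continuous_finsetSum _ fun k _ => continuous_finsetSum _ fun l _ =>
        ((hαc g).comp (by fun_prop)).const_smul _) (by fun_prop))

theorem closure_spectralSpan_subset (hα : IsFDynamicalSystem F α)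
    {Y : NonUnitalStarSubalgebra ℂ X} (hY : IsClosed[fTop F] (Y : Set X)) :
    closure[fTopMat F π.dim] (spectralSpan α (Y : Set X) π :
      Set (Matrix (Fin π.dim) (Fin π.dim) X)) ⊆ adFixedPoints α (Y : Set X) π :=
  let _ := fTopMat F π.dim
  closure_minimal spectralSpan_subset_adFixedPoints (hα.isClosed_adFixedPoints hY)

theorem mem_strongArvesonSpectrum_of_forall_eq_zero (hα : IsFDynamicalSystem F α)
    {Y : NonUnitalStarSubalgebra ℂ X} (hY : IsClosed[fTop F] (Y : Set X)) (h0 : ∀ y ∈ Y, y = 0)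
    (π : Dual G) : π ∈ strongArvesonSpectrum F α (Y : Set X) := by
  refine Set.Subset.antisymm (hα.closure_spectralSpan_subset hY) fun a ha => ?_
  have : a = 0 := Matrix.ext fun i j => h0 _ (ha.1 i j)
  let _ := fTopMat F π.rep.dim
  exact subset_closure (this ▸ zero_mem _)

end IsFDynamicalSystem

theorem map_mul_mul_mem_spectralSubspace {Y Z : Set X} {a : Matrix (Fin π.dim) (Fin π.dim) X}
    (ha : a ∈ spectralSubspace α Z π) {s t : X} (hs : s ∈ fixedSubalgebra α)
    (ht : t ∈ fixedSubalgebra α) (h : ∀ i j, s * a i j * t ∈ Y) :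
    a.map (s * · * t) ∈ spectralSubspace α Y π := by
  refine ⟨h, fun g i j => ?_⟩
  simp only [Matrix.map_apply, map_mul, hs g, ht g, ha.2 g i j, Finset.mul_sum, Finset.sum_mul,
    mul_smul_comm, smul_mul_assoc]

theorem isClosed_closure_fTopMat {E : Type*} [NormedAddCommGroup E] [NormedSpace ℂ E]
    {F : Submodule ℂ (StrongDual ℂ E)} {d : ℕ} (s : Set (Matrix (Fin d) (Fin d) E)) :
    IsClosed (closure[fTopMat F d] s) :=
  (let _ := fTopMat F d; isClosed_closure : IsClosed[fTopMat F d] _).mono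
    (instTopologicalSpaceMatrix_le_fTopMat d)

theorem isClosed_inf_fixedSubalgebra (hα : IsFDynamicalSystem F α)
    {Y : NonUnitalStarSubalgebra ℂ X} (hY : IsClosed[fTop F] (Y : Set X)) :
    IsClosed ((Y ⊓ fixedSubalgebra α : NonUnitalStarSubalgebra ℂ X) : Set X) :=
  (hY.mono le_fTop).inter (hα.isClosed_fixedSubalgebra.mono le_fTop)

section Compression

variable [PartialOrder X] [StarOrderedRing X] {Y : NonUnitalStarSubalgebra ℂ X}

theorem exists_mul_star_le_of_mem_spectralSubspace {a : Matrix (Fin π.dim) (Fin π.dim) X}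
    (ha : a ∈ spectralSubspace α (Y : Set X) π) :
    ∃ h ∈ Y ⊓ fixedSubalgebra α, ∀ i j, a i j * star (a i j) ≤ h :=
  exists_mul_star_le ha.1 (fun _ => 1) π.mat fun g i j => by
    simp [ha.2 g i j, Matrix.one_apply, UnitaryIrrep.coeff]

theorem exists_mul_star_le_of_mem_adFixedPoints {a : Matrix (Fin π.dim) (Fin π.dim) X}
    (ha : a ∈ adFixedPoints α (Y : Set X) π) :
    ∃ h ∈ Y ⊓ fixedSubalgebra α, ∀ i j, a i j * star (a i j) ≤ h :=
  exists_mul_star_le ha.1 (fun g => π.mat g⁻¹) π.mat (aut_apply_of_mem_adFixedPoints ha)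

theorem mem_of_forall_map_mul_mul_mem
    (hY : IsClosed ((Y ⊓ fixedSubalgebra α : NonUnitalStarSubalgebra ℂ X) : Set X))
    {a : Matrix (Fin π.dim) (Fin π.dim) X} (ha : a ∈ adFixedPoints α (Y : Set X) π)
    {D : Set (Matrix (Fin π.dim) (Fin π.dim) X)} (hD : IsClosed D)
    (hmem : ∀ e ∈ Y ⊓ fixedSubalgebra α, ∀ f ∈ Y ⊓ fixedSubalgebra α, a.map (e * · * f) ∈ D) :
    a ∈ D := by
  obtain ⟨h, hh, hle⟩ := exists_mul_star_le_of_mem_adFixedPoints ha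
  obtain ⟨k, hk, hle'⟩ :=
    exists_mul_star_le_of_mem_adFixedPoints (conjTranspose_mem_adFixedPoints ha)
  refine mem_of_forall_map_mul_right_mem hY hk
    (fun i j => by simpa using hle' j i) hD fun f hf => ?_
  exact mem_of_forall_map_mul_left_mem (D := (fun c => c.map (· * f)) ⁻¹' D) hY hh hle
    (hD.preimage (by fun_prop)) fun e he => by simpa [Function.comp_def] using hmem e he f hf

theorem map_conjTranspose_mul_mem_spectralSpan {V : Set X}
    (hY : ∀ x y : X, 0 ≤ x → x ≤ y → y ∈ Y → x ∈ Y) {b c : Matrix (Fin π.dim) (Fin π.dim) X}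
    (hb : b ∈ spectralSubspace α V π) (hc : c ∈ spectralSubspace α V π) {e f u y x x' : X}
    (he : e ∈ Y ⊓ fixedSubalgebra α) (hf : f ∈ Y ⊓ fixedSubalgebra α)
    (hu : u ∈ Y ⊓ fixedSubalgebra α) (hy : y ∈ Y ⊓ fixedSubalgebra α)
    (hx : x ∈ fixedSubalgebra α) (hx' : x' ∈ fixedSubalgebra α) :
    (b.conjTranspose * c.map (x * (u * y) * x' * ·)).map (e * · * f) ∈
      spectralSpan α (Y : Set X) π := by
  refine Submodule.subset_span ⟨b.map (star (x * u) * · * star e),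
    map_mul_mul_mem_spectralSubspace hb (star_mem (mul_mem hx hu.2)) (star_mem he.2)
      fun i j => ?_, c.map (y * x' * · * f),
    map_mul_mul_mem_spectralSubspace hc (mul_mem hy.2 hx') hf.2 fun i j => ?_, ?_⟩
  · rw [star_mul, mul_assoc (star u)]
    exact mul_mul_mem_of_hereditary hY (star_mem hu.1) _ (star_mem he.1)
  · rw [mul_assoc y]
    exact mul_mul_mem_of_hereditary hY hy.1 _ hf.1
  · ext i j
    simp [Matrix.mul_apply, Finset.mul_sum, Finset.sum_mul, mul_assoc]

end Compression

/-- The linear map `z ↦ e (p (z q)) f` obtained by inserting a middle factor `z` into a product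
of matrices `p` and `q` and compressing the entries by `e` and `f`. -/
def insertMap {R n : Type*} [NonUnitalRing R] [Module ℂ R] [IsScalarTower ℂ R R]
    [SMulCommClass ℂ R R] [Fintype n] (p q : Matrix n n R) (e f : R) : R →ₗ[ℂ] Matrix n n R where
  toFun z := (p * q.map (z * ·)).map (e * · * f)
  map_add' z w := by
    ext i j
    simp [Matrix.mul_apply, add_mul, mul_add, Finset.sum_add_distrib]
  map_smul' r z := by
    ext i j
    simp [Matrix.mul_apply, smul_mul_assoc, mul_smul_comm, ← Finset.smul_sum]

theorem continuous_insertMap {R n : Type*} [NonUnitalRing R] [Module ℂ R] [IsScalarTower ℂ R R]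
    [SMulCommClass ℂ R R] [Fintype n] [TopologicalSpace R] [IsSemitopologicalRing R]
    (p q : Matrix n n R) (e f : R) : Continuous (insertMap p q e f) := by
  refine continuous_matrix fun i j => ?_
  simp only [insertMap, LinearMap.coe_mk, AddHom.coe_mk, Matrix.map_apply, Matrix.mul_apply]
  fun_prop

namespace IsFDynamicalSystem

variable [PartialOrder X] [StarOrderedRing X] {Y : NonUnitalStarSubalgebra ℂ X}

theorem insertMap_mem_closure_spectralSpan (hα : IsFDynamicalSystem F α)
    (hYc : IsClosed ((Y ⊓ fixedSubalgebra α : NonUnitalStarSubalgebra ℂ X) : Set X))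
    (hY : ∀ x y : X, 0 ≤ x → x ≤ y → y ∈ Y → x ∈ Y) {V : Set X}
    {b c : Matrix (Fin π.dim) (Fin π.dim) X} (hb : b ∈ spectralSubspace α V π)
    (hc : c ∈ spectralSubspace α V π) {e f z : X} (he : e ∈ Y ⊓ fixedSubalgebra α)
    (hf : f ∈ Y ⊓ fixedSubalgebra α) (hz : z ∈ fixedIdeal F α Y) :
    insertMap b.conjTranspose c e f z ∈ closure[fTopMat F π.dim]
      (spectralSpan α (Y : Set X) π : Set (Matrix (Fin π.dim) (Fin π.dim) X)) := by
  have mem_of_generator : ∀ z ∈ {z | ∃ x ∈ fixedSubalgebra α, ∃ y ∈ Y ⊓ fixedSubalgebra α,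
      ∃ x' ∈ fixedSubalgebra α, z = x * y * x'},
      insertMap b.conjTranspose c e f z ∈ closure[fTopMat F π.dim]
        (spectralSpan α (Y : Set X) π : Set (Matrix (Fin π.dim) (Fin π.dim) X)) := by
    rintro _ ⟨x, hx, y, hy, x', hx', rfl⟩
    obtain ⟨l, _, hleft, -⟩ := exists_approximateUnit hYc
    have hT : Continuous fun w => insertMap b.conjTranspose c e f (x * w * x') :=
      (continuous_insertMap _ _ _ _).comp (by fun_prop)
    refine (isClosed_closure_fTopMat _).mem_of_tendsto
      ((hT.tendsto y).comp (hleft _ (mul_mem hy (star_mem hy)) y le_rfl)) (.of_forall fun u => ?_)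
    let _ := fTopMat F π.dim
    exact subset_closure (map_conjTranspose_mul_mem_spectralSpan hY hb hc he hf u.2 hy hx hx')
  rw [fTopMat_eq] at mem_of_generator ⊢
  let _ := fTop F
  have := isTopologicalAddGroup_fTop (F := F)
  have := continuousSMul_fTop (F := F)
  have := hα.isSemitopologicalRing
  exact map_mem_closure_of_mem_closure_span (continuous_insertMap _ _ _ _) mem_of_generator hz

theorem map_conjTranspose_mul_mem_closure_spectralSpan [IsTopologicalGroup G] [CompactSpace G]
    (hα : IsFDynamicalSystem F α) (hYc : IsClosed[fTop F] (Y : Set X))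
    (hY : ∀ x y : X, 0 ≤ x → x ≤ y → y ∈ Y → x ∈ Y)
    {b c : Matrix (Fin π.dim) (Fin π.dim) X}
    (hb : b ∈ spectralSubspace α (sandwich F (fixedIdeal F α Y)) π)
    (hc : c ∈ spectralSubspace α (sandwich F (fixedIdeal F α Y)) π) {e f : X}
    (he : e ∈ Y ⊓ fixedSubalgebra α) (hf : f ∈ Y ⊓ fixedSubalgebra α) :
    (b.conjTranspose * c).map (e * · * f) ∈ closure[fTopMat F π.dim]
      (spectralSpan α (Y : Set X) π : Set (Matrix (Fin π.dim) (Fin π.dim) X)) := by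
  have hJ := hα.isFClosedIdeal_fixedIdeal Y
  obtain ⟨h, hh, hle⟩ := exists_mul_star_le_of_mem_spectralSubspace (Y := hα.sandwichAlgebra hJ) hc
  refine mem_of_forall_map_mul_left_mem
    (D := (fun c => (b.conjTranspose * c).map (e * · * f)) ⁻¹' closure[fTopMat F π.dim]
      (spectralSpan α (Y : Set X) π : Set (Matrix (Fin π.dim) (Fin π.dim) X)))
    (isClosed_inf_fixedSubalgebra hα (hα.isClosed_sandwichAlgebra hJ)) hh hle
    ((isClosed_closure_fTopMat _).preimage ?_) fun z hz => ?_
  · refine continuous_matrix fun i j => ?_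
    simp only [Matrix.map_apply, Matrix.mul_apply]
    fun_prop
  · exact hα.insertMap_mem_closure_spectralSpan (isClosed_inf_fixedSubalgebra hα hYc) hY hb hc he
      hf (hα.mem_of_mem_sandwich hJ hz.1 hz.2)

theorem map_mul_mul_mem_closure_spectralSpan [IsTopologicalGroup G] [CompactSpace G]
    (hα : IsFDynamicalSystem F α) (hYc : IsClosed[fTop F] (Y : Set X))
    (hY : ∀ x y : X, 0 ≤ x → x ≤ y → y ∈ Y → x ∈ Y) {a : Matrix (Fin π.dim) (Fin π.dim) X}
    (ha : a ∈ closure[fTopMat F π.dim] (spectralSpan α (sandwich F (fixedIdeal F α Y)) π :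
      Set (Matrix (Fin π.dim) (Fin π.dim) X))) {e f : X}
    (he : e ∈ Y ⊓ fixedSubalgebra α) (hf : f ∈ Y ⊓ fixedSubalgebra α) :
    a.map (e * · * f) ∈ closure[fTopMat F π.dim]
      (spectralSpan α (Y : Set X) π : Set (Matrix (Fin π.dim) (Fin π.dim) X)) := by
  have mem_of_generator : ∀ c ∈ {c | ∃ a ∈ spectralSubspace α (sandwich F (fixedIdeal F α Y)) π,
      ∃ b ∈ spectralSubspace α (sandwich F (fixedIdeal F α Y)) π, c = a.conjTranspose * b},
      c.map (e * · * f) ∈ closure[fTopMat F π.dim]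
        (spectralSpan α (Y : Set X) π : Set (Matrix (Fin π.dim) (Fin π.dim) X)) := by
    rintro _ ⟨b, hb, c, hc, rfl⟩
    exact hα.map_conjTranspose_mul_mem_closure_spectralSpan hYc hY hb hc he hf
  rw [fTopMat_eq] at ha mem_of_generator ⊢
  let _ := fTop F
  have := isTopologicalAddGroup_fTop (F := F)
  have := continuousSMul_fTop (F := F)
  have := hα.isSemitopologicalRing
  have hT : Continuous fun c : Matrix (Fin π.dim) (Fin π.dim) X => c.map (e * · * f) := by
    fun_prop
  exact map_mem_closure_of_mem_closure_span
    (T := (LinearMap.mulRight ℂ f ∘ₗ LinearMap.mulLeft ℂ e).mapMatrix) hT mem_of_generator ha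

theorem adFixedPoints_subset_sandwich (hα : IsFDynamicalSystem F α)
    (hYc : IsClosed[fTop F] (Y : Set X)) :
    adFixedPoints α (Y : Set X) π ⊆ adFixedPoints α (sandwich F (fixedIdeal F α Y)) π := by
  intro a ha
  have hYα := isClosed_inf_fixedSubalgebra hα hYc
  have hD : IsClosed {a : Matrix (Fin π.dim) (Fin π.dim) X |
      ∀ i j, a i j ∈ sandwich F (fixedIdeal F α Y)} := by
    have hcl : IsClosed (sandwich F (fixedIdeal F α Y)) :=
      (let _ := fTop F; isClosed_closure : IsClosed[fTop F] _).mono le_fTop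
    simp only [Set.ofPred_forall]
    exact isClosed_iInter fun i => isClosed_iInter fun j => hcl.preimage (by fun_prop)
  exact ⟨mem_of_forall_map_mul_mul_mem hYα ha hD fun e he f hf i j =>
    mul_mul_mem_sandwich_of_mem (mem_fixedIdeal hYα he) _ (mem_fixedIdeal hYα hf), ha.2⟩

theorem mem_strongArvesonSpectrum_of_sandwich [IsTopologicalGroup G] [CompactSpace G]
    (hα : IsFDynamicalSystem F α) (hY : IsInvariantHereditary F α Y) {π : Dual G}
    (hπ : π ∈ strongArvesonSpectrum F α (sandwich F (fixedIdeal F α Y))) :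
    π ∈ strongArvesonSpectrum F α (Y : Set X) := by
  refine Set.Subset.antisymm (hα.closure_spectralSpan_subset hY.isClosed) fun a ha => ?_
  have ha' := hα.adFixedPoints_subset_sandwich hY.isClosed ha
  rw [← hπ] at ha'
  exact mem_of_forall_map_mul_mul_mem (isClosed_inf_fixedSubalgebra hα hY.isClosed) ha
    (isClosed_closure_fTopMat _) fun e he f hf =>
      hα.map_mul_mul_mem_closure_spectralSpan hY.isClosed hY.hereditary ha' he hf

end IsFDynamicalSystem

end Spectral

end FDyn

theorem theorem3p4 {X : Type*} [NonUnitalCStarAlgebra X] [PartialOrder X] [StarOrderedRing X]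
    {G : Type*} [Group G] [TopologicalSpace G] [IsTopologicalGroup G] [CompactSpace G]
    (F : Submodule ℂ (StrongDual ℂ X)) (α : G →* (X ≃⋆ₐ[ℂ] X))
    (hα : FDyn.IsFDynamicalSystem F α) :
    FDyn.strongConnesSpectrum F α =
      ⋂ J ∈ {J : Submodule ℂ X | FDyn.IsFClosedIdeal F α J},
        FDyn.strongArvesonSpectrum F α (FDyn.sandwich F J) := by
  refine Set.Subset.antisymm (fun π hπ => Set.mem_iInter₂.2 fun J hJ => ?_) fun π hπ Y hY =>
    hα.mem_strongArvesonSpectrum_of_sandwich hY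
      (Set.mem_iInter₂.1 hπ _ (hα.isFClosedIdeal_fixedIdeal Y))
  rw [← hα.coe_sandwichAlgebra hJ]
  by_cases hne : ∃ z ∈ hα.sandwichAlgebra hJ, z ≠ 0
  · exact hπ _ (hα.isInvariantHereditary_sandwichAlgebra hJ hne)
  · exact hα.mem_strongArvesonSpectrum_of_forall_eq_zero (hα.isClosed_sandwichAlgebra hJ)
      (fun z hz => by_contra fun h0 => hne ⟨z, hz, h0⟩) π
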